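/- Let $\mathcal M=(M,<,+,0,\ldots)$ be a first-order structure expanding a densely linearly ordered abelian group; "definable" means definable in $\mathcal M$ with parameters from $M$. Assume that $\mathcal M$ is a DCULOAS structure, i.e. that it is - *definably complete*: every nonempty definable subset of $M$ that is bounded above (resp. below) has a supremum (resp. infimum) in $M$; and - *uniformly locally o-minimal of the second kind*: for every definable $X\subseteq M$ and $a\in M$ there is an open interval $I\ni a$ such that $X\cap I$ is a finite union of points and open intervals; moreover, for every integer $n\ge 1$, every definable $X\subseteq M^{n+1}$, every $a\in M$ and every $b\in M^n$, there are an open interval $I\ni a$ and an open box $B\ni b$ in $M^n$ such that for all $y\in B$ the set $\{x\in I: (y,x)\in X\}$ is a finite union of points and open intervals. Give $M$ the order topology, $M^n$ the product topology, and put $|x|=\max_i|x_i|$ for $x\in M^n$. Let $C\subseteq M^n$ be a definable closed and bounded set, let $s>0$ in $M$, and let $\{f_t:C\to M\}_{0<t<s}$ be a family of functions such that - (definable family) the function $C\times{]0,s[}\to M$, $(x,t)\mapsto f_t(x)$, is definable; - (equi-continuity) for all $\varepsilon>0$ and $x\in C$ there is $\delta>0$ such that $|f_t(x)-f_t(x')|<\varepsilon$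 for all $t\in{]0,s[}$ and all $x'\in C$ with $|x-x'|<\delta$; - (pointwise convergence) for all $\varepsilon>0$ and $x\in C$ there is $s'>0$ such that $|f_t(x)-f_{t'}(x)|<\varepsilon$ for all $t,t'\in{]0,s[}$ with $t,t'<s'$. Then the family is uniformly convergent as $t\to 0+$: for every $\varepsilon>0$ there is $s'>0$ such that $|f_t(x)-f_{t'}(x)|<\varepsilon$ for all $x\in C$ and all $t,t'\in{]0,s[}$ with $t,t'<s'$. -/

import Mathlib

universe u v w

namespace Dculoas

open FirstOrder.Language


section Structures

/-- `M` with its `L`-structure is an expansion of the ordered group `(M, <, +, 0)`: the language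
`L` has symbols for `<`, `+` and `0`, interpreted by the order, the addition and the zero
of `M`. The language may contain arbitrarily many further symbols. -/
structure IsExpansion (L : FirstOrder.Language.{u, v}) (M : Type w) [L.Structure M] [LinearOrder M]
    [AddCommGroup M] : Prop where
  lt_symbol : ∃ r : L.Relations 2, ∀ x y : M, Structure.RelMap r ![x, y] ↔ x < y
  add_symbol : ∃ f : L.Functions 2, ∀ x y : M, Structure.funMap f ![x, y] = x + y
  zero_symbol : ∃ c : L.Functions 0, Structure.funMap c ![] = (0 : M)

/-- A subset of `M ^ n` is definable if it is definable in the given structure with parameters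
from `M`. -/
def IsDefinable (L : FirstOrder.Language.{u, v}) {M : Type w} [L.Structure M] {n : ℕ}
    (X : Set (Fin n → M)) : Prop :=
  (Set.univ : Set M).Definable L X

/-- A subset of `M` is definable (with parameters from `M`). -/
def IsDefinable₁ (L : FirstOrder.Language.{u, v}) {M : Type w} [L.Structure M] (X : Set M) : Prop :=
  (Set.univ : Set M).Definable₁ L X

/-- Every definable subset of `M` has a supremum and an infimum in `M ∪ {-∞, +∞}`: a nonempty
definable set that is bounded above has a least upper bound in `M`, and a nonempty definable set
that is bounded below has a greatest lower bound in `M`. -/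
def IsDefinablyComplete (L : FirstOrder.Language.{u, v}) (M : Type w) [L.Structure M] [LinearOrder M] :
    Prop :=
  ∀ X : Set M, IsDefinable₁ L X → X.Nonempty →
    (BddAbove X → ∃ a, IsLUB X a) ∧ (BddBelow X → ∃ a, IsGLB X a)

/-- `X` is a finite union of points and open intervals. -/
def IsFiniteUnionOfPointsAndIntervals {M : Type w} [LinearOrder M] (X : Set M) : Prop :=
  ∃ (P : Set M) (J : Set (M × M)), P.Finite ∧ J.Finite ∧ X = P ∪ ⋃ p ∈ J, Set.Ioo p.1 p.2

/-- Local o-minimality: around each point, every definable subset of `M` coincides with a finite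
union of points and open intervals. -/
def IsLocallyOMinimal (L : FirstOrder.Language.{u, v}) (M : Type w) [L.Structure M] [LinearOrder M] : Prop :=
  ∀ X : Set M, IsDefinable₁ L X → ∀ a : M, ∃ c d : M, a ∈ Set.Ioo c d ∧
    IsFiniteUnionOfPointsAndIntervals (X ∩ Set.Ioo c d)

/-- The fiber `{x ∈ M | (y, x) ∈ X}` of a set `X` in `M ^ (n + 1)` over `y ∈ M ^ n`. -/
def fiber {M : Type w} {n : ℕ} (X : Set (Fin (n + 1) → M)) (y : Fin n → M) : Set M :=
  {x | (Fin.snoc y x : Fin (n + 1) → M) ∈ X}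

/-- The open box `∏ i, ]l i, r i[` in `M ^ n`. -/
def openBox {M : Type w} [LinearOrder M] {n : ℕ} (l r : Fin n → M) : Set (Fin n → M) :=
  {y | ∀ i, y i ∈ Set.Ioo (l i) (r i)}

/-- Uniform local o-minimality of the second kind: for every definable `X` in `M ^ (n + 1)`, every
`a ∈ M` and every `b ∈ M ^ n` there are an open interval `I` around `a` and an open box `B`
around `b` such that `X_y ∩ I` is a finite union of points and open intervals for
all `y ∈ B`. -/
def IsUniformlyLocallyOMinimalSecondKind (L : FirstOrder.Language.{u, v}) (M : Type w) [L.Structure M]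
    [LinearOrder M] : Prop :=
  IsLocallyOMinimal L M ∧
    ∀ n : ℕ, 0 < n → ∀ X : Set (Fin (n + 1) → M), IsDefinable L X →
      ∀ (a : M) (b : Fin n → M), ∃ (c d : M) (l r : Fin n → M),
        a ∈ Set.Ioo c d ∧ b ∈ openBox l r ∧
          ∀ y ∈ openBox l r, IsFiniteUnionOfPointsAndIntervals (fiber X y ∩ Set.Ioo c d)

/-- A DCULOAS structure: a definably complete uniformly locally o-minimal expansion of the second
kind of a densely linearly ordered abelian group. -/
structure IsDCULOAS (L : FirstOrder.Language.{u, v}) (M : Type w) [L.Structure M] [LinearOrder M]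
    [AddCommGroup M] [IsOrderedAddMonoid M] [DenselyOrdered M] : Prop where
  expansion : IsExpansion L M
  definablyComplete : IsDefinablyComplete L M
  uniformlyLocallyOMinimal : IsUniformlyLocallyOMinimalSecondKind L M

end Structures

section Functions

variable {M : Type w} [LinearOrder M] [AddCommGroup M] {n : ℕ}

/-- `|x| = max_i |x_i|` for `x ∈ M ^ n` (it is `0` when `n = 0`). -/
def maxNorm (x : Fin n → M) : M := Finset.univ.fold max 0 fun i => |x i|

theorem maxNorm_lt_iff {x : Fin n → M} {r : M} (hr : 0 < r) :
    maxNorm x < r ↔ ∀ i, |x i| < r := by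
  simp [maxNorm, Finset.fold_max_lt, hr]

/-- A bounded subset of `M ^ n`. -/
def IsBoundedSet (C : Set (Fin n → M)) : Prop := ∃ N : M, ∀ x ∈ C, maxNorm x ≤ N

/-- A function `F : C × P → M` is equi-continuous with respect to `P`. -/
def IsEquicontinuousWrt {C : Set (Fin n → M)} {P : Type*} (F : C × P → M) : Prop :=
  ∀ ε : M, 0 < ε → ∀ x : C, ∃ δ : M, 0 < δ ∧ ∀ (p : P) (x' : C),
    maxNorm ((x : Fin n → M) - (x' : Fin n → M)) < δ → |F (x, p) - F (x', p)| < ε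

/-- A family `{f_t : C → M}`, `0 < t < s`, is a definable family if the function
`(x, t) ↦ f_t x` on `C × ]0, s[` is definable, that is, its graph in `M ^ (n + 2)` is. -/
def IsDefinableFamily (L : FirstOrder.Language.{u, v}) [L.Structure M] {C : Set (Fin n → M)} {s : M}
    (f : Set.Ioo 0 s → C → M) : Prop :=
  IsDefinable L {z : Fin (n + 1 + 1) → M | ∃ (x : C) (t : Set.Ioo 0 s),
    z = Fin.snoc (Fin.snoc (x : Fin n → M) (t : M) : Fin (n + 1) → M) (f t x)}

/-- The family `{f_t}` is equi-continuous: `(x, t) ↦ f_t x` is equi-continuous with respect to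
the parameter interval `]0, s[`. -/
def IsEquicontinuousFamily {C : Set (Fin n → M)} {s : M} (f : Set.Ioo 0 s → C → M) : Prop :=
  IsEquicontinuousWrt fun q : C × Set.Ioo 0 s => f q.2 q.1

/-- Pointwise convergence of the family `{f_t}` as `t → 0+` (as a Cauchy condition). -/
def IsPointwiseConvergent {C : Set (Fin n → M)} {s : M} (f : Set.Ioo 0 s → C → M) : Prop :=
  ∀ ε : M, 0 < ε → ∀ x : C, ∃ s' : M, 0 < s' ∧
    ∀ t t' : Set.Ioo 0 s, (t : M) < s' → (t' : M) < s' → |f t x - f t' x| < ε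

/-- Uniform convergence of the family `{f_t}` as `t → 0+` (as a Cauchy condition). -/
def IsUniformlyConvergent {C : Set (Fin n → M)} {s : M} (f : Set.Ioo 0 s → C → M) : Prop :=
  ∀ ε : M, 0 < ε → ∃ s' : M, 0 < s' ∧
    ∀ (x : C) (t t' : Set.Ioo 0 s), (t : M) < s' → (t' : M) < s' → |f t x - f t' x| < ε

end Functions

end Dculoas

namespace Dculoas

open FirstOrder FirstOrder.Language

/-! ### Closure properties of definable sets. -/

section Definability

variable {L : FirstOrder.Language.{u, v}} {M : Type w} [L.Structure M]

variable {α : Type*}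

/-! If uniform convergence fails for `ε`, then for each `r > 0` some point of `C` has two members of
the family with parameters below `r` differing there by at least `ε`. These bad points form a
definable family of bounded sets, shrinking with `r`, so definable compactness
(`exists_cluster_point`) yields a cluster point `y`, which lies in the closed set `C`.
Equi-continuity at `y` transfers the oscillation of a nearby bad point to `y`, contradicting
convergence there.

The compactness needs no choice of a curve: `y` is built coordinatewise as iterated lower limits,
suprema that definable completeness provides. -/

theorem termDefinable_var (i : α) : (Set.univ : Set M).TermDefinable L fun v : α → M => v i :=
  ⟨Term.var i, rfl⟩

theorem termDefinable_const (c : M) : (Set.univ : Set M).TermDefinable L fun _ : α → M => c :=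
  ⟨(L.con (⟨c, trivial⟩ : (Set.univ : Set M))).term, by
    ext v; simp⟩

theorem definable_exists {β : Type*} [Finite α] [Finite β] {S : Set (α ⊕ β → M)}
    (hS : (Set.univ : Set M).Definable L S) :
    (Set.univ : Set M).Definable L {v : α → M | ∃ w : β → M, Sum.elim v w ∈ S} := by
  convert hS.image_comp (Sum.inl : α → α ⊕ β) using 1
  ext v
  constructor
  · rintro ⟨w, hw⟩
    exact ⟨_, hw, rfl⟩
  · rintro ⟨u, hu, rfl⟩
    exact ⟨u ∘ Sum.inr, by simpa using hu⟩

variable [LinearOrder M] [AddCommGroup M]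

theorem IsExpansion.termDefinable_add (h : IsExpansion L M) {σ τ : (α → M) → M}
    (hσ : (Set.univ : Set M).TermDefinable L σ) (hτ : (Set.univ : Set M).TermDefinable L τ) :
    (Set.univ : Set M).TermDefinable L fun v => σ v + τ v := by
  obtain ⟨a, rfl⟩ := hσ
  obtain ⟨b, rfl⟩ := hτ
  obtain ⟨f, hf⟩ := h.add_symbol
  refine ⟨((L.lhomWithConstants (Set.univ : Set M)).onFunction f).apply₂ a b, ?_⟩
  ext v
  rw [Term.realize_functions_apply₂, LHom.map_onFunction, hf]

theorem IsExpansion.definable_lt (h : IsExpansion L M) {σ τ : (α → M) → M}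
    (hσ : (Set.univ : Set M).TermDefinable L σ) (hτ : (Set.univ : Set M).TermDefinable L τ) :
    (Set.univ : Set M).Definable L {v | σ v < τ v} := by
  obtain ⟨a, rfl⟩ := hσ
  obtain ⟨b, rfl⟩ := hτ
  obtain ⟨r, hr⟩ := h.lt_symbol
  refine ⟨((L.lhomWithConstants (Set.univ : Set M)).onRelation r).formula₂ a b, ?_⟩
  ext v
  rw [Set.mem_ofPred_eq, Set.mem_ofPred_eq, Formula.realize_rel₂, LHom.map_onRelation, hr]

/-- Only addition is assumed to have a symbol, so the condition is split into two inequalities free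
of subtraction. -/
theorem IsExpansion.definable_abs_sub_lt [IsOrderedAddMonoid M] (h : IsExpansion L M)
    {ρ σ τ : (α → M) → M} (hρ : (Set.univ : Set M).TermDefinable L ρ)
    (hσ : (Set.univ : Set M).TermDefinable L σ) (hτ : (Set.univ : Set M).TermDefinable L τ) :
    (Set.univ : Set M).Definable L {v | |σ v - τ v| < ρ v} := by
  have key : {v | |σ v - τ v| < ρ v} = {v | σ v < ρ v + τ v} ∩ {v | τ v < σ v + ρ v} := by
    ext v
    simp only [Set.mem_ofPred_eq, Set.mem_inter_iff, abs_lt]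
    constructor
    · rintro ⟨h1, h2⟩
      exact ⟨sub_lt_iff_lt_add.1 h2, by rw [neg_lt_sub_iff_lt_add'] at h1; exact h1⟩
    · rintro ⟨h1, h2⟩
      exact ⟨by rw [neg_lt_sub_iff_lt_add']; exact h2, sub_lt_iff_lt_add.2 h1⟩
  rw [key]
  exact (h.definable_lt hσ (h.termDefinable_add hρ hτ)).inter
    (h.definable_lt hτ (h.termDefinable_add hσ hρ))

end Definability

theorem abs_apply_le_maxNorm {M : Type*} [LinearOrder M] [AddCommGroup M] {n : ℕ}
    (x : Fin n → M) (i : Fin n) :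
    |x i| ≤ maxNorm x :=
  Finset.le_fold_max _ |>.2 (Or.inr ⟨i, Finset.mem_univ i, le_rfl⟩)

/-! ### Definable compactness and the set of bad points. -/

section ClusterPoint

variable {L : FirstOrder.Language.{u, v}} {M : Type w} [L.Structure M] [LinearOrder M]
  [AddCommGroup M] [IsOrderedAddMonoid M] {n : ℕ}

/-- The lower bounds of a coordinate on the members of a definable family that are close to a
given point in some of the other coordinates form a definable set. -/
theorem IsExpansion.definable_eventual_lowerBounds (h : IsExpansion L M)
    {Z : Set (Fin (n + 1) → M)} (hZ : IsDefinable L Z) (I : Finset (Fin n)) (y : Fin n → M)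
    (k : Fin n) :
    IsDefinable₁ L {c : M | ∃ r : M, 0 < r ∧ ∀ x : Fin n → M,
      (Fin.snoc x r : Fin (n + 1) → M) ∈ Z → (∀ i ∈ I, |x i - y i| < r) → c ≤ x k} := by
  -- The three blocks of variables are `c`, `r` and `x`. The universal clause over `x` is the
  -- complement of the projection of its counterexamples `hA`.
  let g : Fin (n + 1) → (Fin 1 ⊕ Fin 1) ⊕ Fin n := Fin.snoc Sum.inr (Sum.inl (Sum.inr 0))
  have hA : (Set.univ : Set M).Definable L
      (((fun v : (Fin 1 ⊕ Fin 1) ⊕ Fin n → M => v ∘ g) ⁻¹' Z ∩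
        ⋂ i ∈ I, {v | |v (Sum.inr i) - y i| < v (Sum.inl (Sum.inr 0))}) ∩
        {v | v (Sum.inr k) < v (Sum.inl (Sum.inl 0))}) :=
    ((Set.Definable.preimage_comp g hZ).inter
      (Set.definable_biInter_finset (fun i => h.definable_abs_sub_lt (termDefinable_var _)
        (termDefinable_var _) (termDefinable_const _)) I)).inter
      (h.definable_lt (termDefinable_var _) (termDefinable_var _))
  have hB := definable_exists ((h.definable_lt (termDefinable_const 0)
    (termDefinable_var (Sum.inr 0))).inter (definable_exists hA).compl)
  unfold IsDefinable₁ Set.Definable₁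
  convert hB using 1
  ext v
  have hg : ∀ (r x), (Sum.elim (Sum.elim v r) x) ∘ g = (Fin.snoc x (r 0) : Fin (n + 1) → M) := by
    intro r x
    ext j
    refine Fin.lastCases ?_ (fun j => ?_) j <;> simp [g]
  constructor
  · rintro ⟨r, hr, H⟩
    refine ⟨fun _ => r, hr, ?_⟩
    rintro ⟨x, ⟨hx, hxI⟩, hk⟩
    rw [Set.mem_preimage, hg] at hx
    exact absurd hk (not_lt.2 (H x hx fun i hi => by simpa using Set.mem_iInter₂.1 hxI i hi))
  · rintro ⟨r, hr, H⟩
    refine ⟨r 0, hr, fun x hx hxI => not_lt.1 fun hk => H ⟨x, ⟨?_, ?_⟩, hk⟩⟩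
    · rw [Set.mem_preimage, hg]
      exact hx
    · exact Set.mem_iInter₂.2 fun i hi => by simpa using hxI i hi

/-- Definable compactness: a definable monotone family of nonempty, uniformly bounded subsets
of `M ^ n` has a common cluster point. -/
theorem exists_cluster_point (h : IsExpansion L M) (hc : IsDefinablyComplete L M)
    {Z : Set (Fin (n + 1) → M)} (hZ : IsDefinable L Z)
    (hmono : ∀ (x : Fin n → M) (r r' : M), r ≤ r' → (Fin.snoc x r : Fin (n + 1) → M) ∈ Z →
      (Fin.snoc x r' : Fin (n + 1) → M) ∈ Z)
    (hne : ∀ r : M, 0 < r → ∃ x : Fin n → M, (Fin.snoc x r : Fin (n + 1) → M) ∈ Z)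
    {N : M} (hN : ∀ (x : Fin n → M) (r : M), (Fin.snoc x r : Fin (n + 1) → M) ∈ Z →
      maxNorm x ≤ N) :
    ∃ y : Fin n → M, ∀ r : M, 0 < r → ∃ x : Fin n → M,
      (Fin.snoc x r : Fin (n + 1) → M) ∈ Z ∧ ∀ i, |x i - y i| < r := by
  -- Induct on the set of coordinates in which clustering is already achieved.
  suffices H : ∀ I : Finset (Fin n), ∃ y : Fin n → M, ∀ r : M, 0 < r → ∃ x : Fin n → M,
      (Fin.snoc x r : Fin (n + 1) → M) ∈ Z ∧ ∀ i ∈ I, |x i - y i| < r by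
    simpa using H Finset.univ
  intro I
  induction I using Finset.induction_on with
  | empty => exact ⟨0, fun r hr => by simpa using hne r hr⟩
  | insert k I hk ih =>
    obtain ⟨y, hy⟩ := ih
    -- Some positive scale is needed for `-N` to be an eventual lower bound; without one the claim
    -- is vacuous.
    by_cases hpos : ∃ r₀ : M, 0 < r₀
    swap
    · exact ⟨y, fun r hr => (hpos ⟨r, hr⟩).elim⟩
    obtain ⟨r₀, hr₀⟩ := hpos
    have hbd : ∀ (x : Fin n → M) (r : M), (Fin.snoc x r : Fin (n + 1) → M) ∈ Z →
        -N ≤ x k ∧ x k ≤ N := fun x r hx =>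
      abs_le.1 ((abs_apply_le_maxNorm x k).trans (hN x r hx))
    -- `a` is the lower limit of the `k`-th coordinate along members approaching `y` in the
    -- coordinates of `I`.
    obtain ⟨a, ha⟩ := (hc _ (h.definable_eventual_lowerBounds hZ I y k)
      ⟨-N, r₀, hr₀, fun x hx _ => (hbd x _ hx).1⟩).1 ⟨N, by
        rintro c ⟨r, hr, H⟩
        obtain ⟨x, hx, hxI⟩ := hy r hr
        exact (H x hx hxI).trans (hbd x r hx).2⟩
    refine ⟨Function.update y k a, fun r hr => ?_⟩
    -- Beyond scale `r₁` every such member has `k`-th coordinate above `a - r`; as `a + r` is not an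
    -- eventual lower bound, one at scale `min r r₁` lies below `a + r`.
    obtain ⟨c, ⟨r₁, hr₁, hc₁⟩, hac, -⟩ := ha.exists_between (sub_lt_self a hr)
    have har : ¬ ∀ x : Fin n → M, (Fin.snoc x (min r r₁) : Fin (n + 1) → M) ∈ Z →
        (∀ i ∈ I, |x i - y i| < min r r₁) → a + r ≤ x k := fun H =>
      (lt_add_of_pos_right a hr).not_ge (ha.1 ⟨min r r₁, lt_min hr hr₁, H⟩)
    push Not at har
    obtain ⟨x, hx, hxI, hxk⟩ := har
    refine ⟨x, hmono x _ _ (min_le_left _ _) hx, fun i hi => ?_⟩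
    by_cases hik : i = k
    · subst hik
      rw [Function.update_self, abs_lt, neg_lt_sub_iff_lt_add, sub_lt_iff_lt_add']
      refine ⟨sub_lt_iff_lt_add'.1 (hac.trans_le (hc₁ x (hmono x _ _ (min_le_right _ _) hx)
        fun j hj => (hxI j hj).trans_le (min_le_right _ _))), hxk⟩
    · rw [Function.update_of_ne hik]
      exact (hxI i ((Finset.mem_insert.1 hi).resolve_left hik)).trans_le (min_le_left _ _)

theorem mem_of_isClosed_of_forall_abs_sub_lt [Nontrivial M] [TopologicalSpace M] [OrderTopology M]
    {C : Set (Fin n → M)} (hC : IsClosed C) {y : Fin n → M}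
    (hy : ∀ r : M, 0 < r → ∃ x ∈ C, ∀ i, |x i - y i| < r) : y ∈ C := by
  by_contra hyC
  obtain ⟨U, hU, hUC⟩ := isOpen_pi_iff'.1 hC.isOpen_compl y hyC
  -- Radii live in the subtype of positive elements, so a lower bound of their finite range is again
  -- positive, even for `n = 0`.
  have hδ : ∀ i, ∃ δ : Set.Ioi (0 : M), ∀ b, |b - y i| < δ → b ∈ U i := fun i => by
    obtain ⟨δ, hδ, hs⟩ := (nhds_basis_abs_sub_lt (y i)).mem_iff.1 ((hU i).1.mem_nhds (hU i).2)
    exact ⟨⟨δ, hδ⟩, fun b hb => hs hb⟩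
  choose δ hδ using hδ
  obtain ⟨e, he⟩ := (Set.finite_range δ).bddBelow
  obtain ⟨x, hx, hxy⟩ := hy e e.2
  exact hUC (fun i _ => hδ i _ ((hxy i).trans_le (he ⟨i, rfl⟩))) hx

/-- The set of `(x, r)` such that `f_t x` and `f_t' x` differ by at least `ε` for some
`t, t' < r`. -/
def oscillationSet {C : Set (Fin n → M)} {s : M} (f : Set.Ioo 0 s → C → M) (ε : M) :
    Set (Fin (n + 1) → M) :=
  {z | ∃ (x : C) (t t' : Set.Ioo 0 s), (x : Fin n → M) = Fin.init z ∧ (t : M) < z (Fin.last n) ∧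
    (t' : M) < z (Fin.last n) ∧ ε ≤ |f t x - f t' x|}

theorem IsExpansion.definable_oscillationSet (h : IsExpansion L M) {C : Set (Fin n → M)} {s : M}
    {f : Set.Ioo 0 s → C → M} (hf : IsDefinableFamily L f) (ε : M) :
    IsDefinable L (oscillationSet f ε) := by
  let g (a b : Fin 4) : Fin (n + 1 + 1) → Fin (n + 1) ⊕ Fin 4 :=
    Fin.snoc (Fin.snoc (fun i => Sum.inl i.castSucc) (Sum.inr a) :
      Fin (n + 1) → Fin (n + 1) ⊕ Fin 4) (Sum.inr b)
  have hg : ∀ (a b : Fin 4) (z : Fin (n + 1) → M) (w : Fin 4 → M), Sum.elim z w ∘ g a b =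
      Fin.snoc (Fin.snoc (Fin.init z) (w a) : Fin (n + 1) → M) (w b) := by
    intro a b z w
    ext j
    refine Fin.lastCases (by simp [g]) (fun j => ?_) j
    refine Fin.lastCases (by simp [g]) (fun j => ?_) j
    simp [g, Fin.init]
  have hlast (a : Fin 4) : (Set.univ : Set M).Definable L
      {v : Fin (n + 1) ⊕ Fin 4 → M | v (Sum.inr a) < v (Sum.inl (Fin.last n))} :=
    h.definable_lt (termDefinable_var _) (termDefinable_var _)
  have hA := definable_exists (((Set.Definable.preimage_comp (g 0 1) hf).inter
    (Set.Definable.preimage_comp (g 2 3) hf)).inter (((hlast 0).inter (hlast 2)).inter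
    (h.definable_abs_sub_lt (termDefinable_const ε) (termDefinable_var (Sum.inr 1))
      (termDefinable_var (Sum.inr 3))).compl))
  unfold IsDefinable
  convert hA using 1
  ext z
  constructor
  · rintro ⟨x, t, t', hx, ht, ht', hε⟩
    -- The four quantified variables are the two parameters, each followed by its value, matching `g
    -- 0 1` and `g 2 3`.
    refine ⟨![t, f t x, t', f t' x], ⟨?_, ?_⟩, ⟨ht, ht'⟩, not_lt.2 hε⟩
    · rw [Set.mem_preimage, hg]
      exact ⟨x, t, by rw [hx]; rfl⟩
    · rw [Set.mem_preimage, hg]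
      exact ⟨x, t', by rw [hx]; rfl⟩
  · rintro ⟨w, ⟨h1, h2⟩, ⟨h3, h4⟩, h5⟩
    rw [Set.mem_preimage, hg] at h1 h2
    obtain ⟨x, t, h1⟩ := h1
    obtain ⟨x', t', h2⟩ := h2
    obtain ⟨h1, h1f⟩ := Fin.snoc_injective2 h1
    obtain ⟨h1x, h1t⟩ := Fin.snoc_injective2 h1
    obtain ⟨h2, h2f⟩ := Fin.snoc_injective2 h2
    obtain ⟨h2x, h2t⟩ := Fin.snoc_injective2 h2
    obtain rfl : x = x' := Subtype.ext (h1x.symm.trans h2x)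
    refine ⟨x, t, t', h1x.symm, h1t ▸ h3, h2t ▸ h4, ?_⟩
    rw [← h1f, ← h2f]
    exact not_lt.1 h5

end ClusterPoint

/-- Replaces halving, since the group need not be divisible: cut `ε` into two positive pieces and
take the smaller. -/
theorem exists_pos_add_self_le {M : Type*} [LinearOrder M] [AddCommGroup M]
    [IsOrderedAddMonoid M] [DenselyOrdered M] {ε : M} (hε : 0 < ε) :
    ∃ η : M, 0 < η ∧ η + η ≤ ε := by
  obtain ⟨a, ha, haε⟩ := exists_between hε
  refine ⟨min a (ε - a), lt_min ha (sub_pos.2 haε), ?_⟩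
  calc _ ≤ a + (ε - a) := add_le_add (min_le_left _ _) (min_le_right _ _)
    _ = ε := add_sub_cancel a ε

end Dculoas

open Dculoas in
theorem theorem4p10 (L : FirstOrder.Language.{u, v}) (M : Type w) [L.Structure M]
    [LinearOrder M] [AddCommGroup M] [IsOrderedAddMonoid M] [DenselyOrdered M]
    [TopologicalSpace M] [OrderTopology M]
    (hM : Dculoas.IsDCULOAS L M)
    (n : ℕ) (C : Set (Fin n → M)) (hCdef : Dculoas.IsDefinable L C)
    (hCclosed : IsClosed C) (hCbdd : Dculoas.IsBoundedSet C)
    (s : M) (hs : 0 < s) (f : Set.Ioo 0 s → C → M)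
    (hdef : Dculoas.IsDefinableFamily L f)
    (hequi : Dculoas.IsEquicontinuousFamily f)
    (hconv : Dculoas.IsPointwiseConvergent f) :
    Dculoas.IsUniformlyConvergent f := by
  have : Nontrivial M := ⟨0, s, hs.ne⟩
  intro ε hε
  by_contra! hcon
  obtain ⟨N, hN⟩ := hCbdd
  obtain ⟨y, hy⟩ := exists_cluster_point hM.expansion hM.definablyComplete
    (hM.expansion.definable_oscillationSet hdef ε)
    (fun x r r' hr => by
      rintro ⟨x', t, t', hx, ht, ht', h⟩
      simp only [Fin.init_snoc, Fin.snoc_last] at hx ht ht'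
      exact ⟨x', t, t', by simpa using hx, by simpa using ht.trans_le hr,
        by simpa using ht'.trans_le hr, h⟩)
    (fun r hr => by
      obtain ⟨x, t, t', ht, ht', h⟩ := hcon r hr
      exact ⟨x, x, t, t', by simp, by simpa using ht, by simpa using ht', h⟩)
    (N := N)
    (fun x r => by
      rintro ⟨x', t, t', hx, -⟩
      rw [Fin.init_snoc] at hx
      exact hx ▸ hN x' x'.2)
  have hyC : y ∈ C := mem_of_isClosed_of_forall_abs_sub_lt hCclosed fun r hr => by
    obtain ⟨x, ⟨x', t, t', hx, -⟩, hxy⟩ := hy r hr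
    rw [Fin.init_snoc] at hx
    exact ⟨x, hx ▸ x'.2, hxy⟩
  -- The final estimate has three terms; two halvings give `η` with four copies below `ε`.
  obtain ⟨ε₁, hε₁, h₁⟩ := exists_pos_add_self_le hε
  obtain ⟨η, hη, h₂⟩ := exists_pos_add_self_le hε₁
  obtain ⟨δ, hδ, hequi⟩ := hequi η hη ⟨y, hyC⟩
  obtain ⟨s', hs', hconv⟩ := hconv η hη ⟨y, hyC⟩
  obtain ⟨x, ⟨x', t, t', hx, ht, ht', h⟩, hxy⟩ := hy (min δ s') (lt_min hδ hs')
  simp only [Fin.init_snoc, Fin.snoc_last] at hx ht ht'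
  have hclose : maxNorm (y - (x' : Fin n → M)) < δ := (maxNorm_lt_iff hδ).2 fun i => by
    rw [hx, Pi.sub_apply, abs_sub_comm]
    exact (hxy i).trans_le (min_le_left _ _)
  have e₁ := hequi t x' hclose
  have e₂ := hequi t' x' hclose
  have e₃ := hconv t t' (ht.trans_le (min_le_right _ _)) (ht'.trans_le (min_le_right _ _))
  simp only at e₁ e₂
  rw [abs_sub_comm] at e₁
  refine absurd h (not_le.2 ?_)
  calc |f t x' - f t' x'|
      ≤ |f t x' - f t ⟨y, hyC⟩| + |f t ⟨y, hyC⟩ - f t' x'| := abs_sub_le _ _ _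
    _ ≤ |f t x' - f t ⟨y, hyC⟩| + (|f t ⟨y, hyC⟩ - f t' ⟨y, hyC⟩| +
        |f t' ⟨y, hyC⟩ - f t' x'|) := by gcongr; exact abs_sub_le _ _ _
    _ < η + (η + η) := add_lt_add e₁ (add_lt_add e₃ e₂)
    _ ≤ ε₁ + ε₁ := add_le_add ((le_add_of_nonneg_left hη.le).trans h₂) h₂
    _ ≤ ε := h₁
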